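/- **Setting.** Let $G_{\mathrm{bip}}(n,p)$ be the random bipartite graph on $L\cup R$, $|L|=|R|=n$, in which each of the $n^2$ pairs in $L\times R$ is an edge independently with probability $p$. An independent set $I$ is $\gamma$-balanced if $\bigl||I\cap L|-\gamma|I|\bigr|<1$ or $\bigl||I\cap R|-\gamma|I|\bigr|<1$. Let $b=1/(1-p)$ and $\alpha_{\mathrm{COMP}}=\frac{\log_b n}{\gamma}$. A randomized online algorithm has a random seed $\omega$, independent of the graph, and runs for $2n$ rounds. In round $t$ it selects, from $\omega$ and all information revealed so far, a vertex $v_t$ not selected before; the status of all pairs $(v_t,v_s)$, $s<t$, is revealed; then, from the information revealed so far and possibly $\omega$, it decides irrevocably whether to add $v_t$ to its output. An arrival rule is any (randomized, adaptive) rule for selecting the $v_t$ of this kind; an acceptance rule is a rule for the decisions. An acceptance rule that is fixed before the arrival rule is chosen and does not use $\omega$ is called oblivious to the arrival order. For integers $a,r\ge 0$ the two-stage acceptance rule with thresholds $(a,r)$ is the following. Let $I$ denote the set constructed so far, initially empty. Stage one: as long as $\max\{|I\cap L|,|I\cap R|\}<a$, add $v_t$ if and only if it has no neighbour in $I$. Stage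 two: once $I$ has $a$ vertices on one side (if $a=0$, which holds for both sides at the start, take $L$), add $v_t$ if and only if it lies on the other side, $I$ has fewer than $r$ vertices on that other side, and $v_t$ has no neighbour in $I$. **Theorem.** For all $\epsilon>0$ and $p,\gamma\in(0,1)$ there are deterministic acceptance rules, one for each $n$, oblivious to the arrival order and each a two-stage rule for some thresholds $(a_n,r_n)$, and constants $c>0$ and $n_0$, depending only on $\epsilon,p,\gamma$, such that for every $n\ge n_0$ and every arrival rule the resulting online algorithm, run on $G\sim G_{\mathrm{bip}}(n,p)$, outputs a $\gamma$-balanced independent set of size at least $(1-\epsilon)\alpha_{\mathrm{COMP}}$ with probability at least $$1-\exp\left(-c\,n^{\epsilon/2}\right).$$ -/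

import Mathlib

open MeasureTheory

namespace BipOnline

/-- The vertex set `L ∪ R` with `|L| = |R| = n`: `Sum.inl i` are the vertices of `L`, `Sum.inr j`
those of `R`. -/
abbrev Vertex (n : ℕ) : Type := Fin n ⊕ Fin n

/-- An edge vector in `{0,1}^(n²)`: `E (i, j)` says whether the `i`-th vertex of `L` and the `j`-th
vertex of `R` are joined. -/
abbrev EdgeVec (n : ℕ) : Type := Fin n × Fin n → Bool

/-- Adjacency in the bipartite graph with edge vector `E`. -/
def adj {n : ℕ} (E : EdgeVec n) : Vertex n → Vertex n → Bool
  | Sum.inl i, Sum.inr j => E (i, j)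
  | Sum.inr j, Sum.inl i => E (i, j)
  | Sum.inl _, Sum.inl _ => false
  | Sum.inr _, Sum.inr _ => false

/-- The bipartite graph with edge vector `E`. -/
def bipGraph {n : ℕ} (E : EdgeVec n) : SimpleGraph (Vertex n) where
  Adj u v := adj E u v = true
  symm := ⟨by rintro (i | i) (j | j) h <;> simp_all [adj]⟩
  loopless := ⟨by rintro (i | i) h <;> simp [adj] at h⟩

/-- The law of `G_bip(n, p)`: the `n²` possible edges are present independently with
probability `p`. -/
noncomputable def bipLaw (n : ℕ) (p : unitInterval) : Measure (EdgeVec n) :=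
  Measure.pi fun _ => ProbabilityTheory.bernoulliMeasure true false p

/-- The number of vertices of `I` in `L` (for `s = true`) or in `R` (for `s = false`). -/
def sideCard {n : ℕ} (s : Bool) (I : Finset (Vertex n)) : ℕ :=
  (I.filter fun v => v.isLeft = s).card

/-- `I` is `γ`-balanced: `||I ∩ L| - γ |I|| < 1` or `||I ∩ R| - γ |I|| < 1`. -/
def IsBalanced {n : ℕ} (γ : ℝ) (I : Finset (Vertex n)) : Prop :=
  |(sideCard true I : ℝ) - γ * (I.card : ℝ)| < 1 ∨
    |(sideCard false I : ℝ) - γ * (I.card : ℝ)| < 1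

/-! ### Online algorithms -/

/-- The record of one round: the inspected vertex, its neighbours among the vertices inspected
before it, and whether it was put into the independent set. -/
structure Round (n : ℕ) where
  vertex : Vertex n
  nbrs : Finset (Vertex n)
  accepted : Bool

/-- All the information revealed so far: the records of the past rounds, latest round first. -/
abbrev History (n : ℕ) : Type := List (Round n)

/-- The vertices inspected so far. -/
def seen {n : ℕ} (h : History n) : Finset (Vertex n) :=
  (h.map Round.vertex).toFinset

/-- The set constructed so far. -/
def chosen {n : ℕ} (h : History n) : Finset (Vertex n) :=
  ((h.filter Round.accepted).map Round.vertex).toFinset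

/-- A vertex arrival order: in every round the next vertex, not inspected before, is selected from
the seed `ω` and from all the information revealed so far. -/
structure ArrivalRule (n : ℕ) (Ω : Type*) [MeasurableSpace Ω] where
  select : Ω → History n → Vertex n
  select_notMem_seen : ∀ ω h, seen h ≠ Finset.univ → select ω h ∉ seen h
  measurableSet_select : ∀ h v, MeasurableSet {ω | select ω h = v}

/-- A randomized online algorithm with seed in `Ω`: after selecting a vertex and seeing its
edges to the vertices inspected before, it decides irrevocably, from the seed and all the
information revealed so far, whether to accept the vertex. -/
structure OnlineAlgorithm (n : ℕ) (Ω : Type*) [MeasurableSpace Ω] extends ArrivalRule n Ω where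
  accept : Ω → History n → Vertex n → Finset (Vertex n) → Bool
  measurableSet_accept : ∀ h v N, MeasurableSet {ω | accept ω h v N = true}

/-- The history of a run of the algorithm on the graph with edge vector `E` after `t` rounds. -/
def OnlineAlgorithm.history {n : ℕ} {Ω : Type*} [MeasurableSpace Ω] (A : OnlineAlgorithm n Ω)
    (ω : Ω) (E : EdgeVec n) : ℕ → History n
  | 0 => []
  | t + 1 =>
    let h := A.history ω E t
    let v := A.select ω h
    let N := (seen h).filter fun u => adj E v u
    ⟨v, N, A.accept ω h v N⟩ :: h

/-- The set returned after all `2n` rounds. -/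
def OnlineAlgorithm.output {n : ℕ} {Ω : Type*} [MeasurableSpace Ω] (A : OnlineAlgorithm n Ω)
    (ω : Ω) (E : EdgeVec n) : Finset (Vertex n) :=
  chosen (A.history ω E (2 * n))

/-- The algorithm `A`, with seed drawn from `μ`, `(k, δ)`-optimizes the `γ`-balanced independent
set problem in `G_bip(n, p)`: with probability at least `δ`, its output is a `γ`-balanced
independent set of size at least `k`. The seed is independent of the graph. -/
def OnlineAlgorithm.Optimizes {n : ℕ} {Ω : Type*} [MeasurableSpace Ω] (A : OnlineAlgorithm n Ω)
    (μ : Measure Ω) (p : unitInterval) (γ k δ : ℝ) : Prop :=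
  δ ≤ (μ.prod (bipLaw n p)).real {x |
    (bipGraph x.2).IsIndepSet (A.output x.1 x.2 : Set (Vertex n)) ∧
      IsBalanced γ (A.output x.1 x.2) ∧ k ≤ ((A.output x.1 x.2).card : ℝ)}

/-- A deterministic rule for accepting vertices that does not know the arrival order: it sees only
the past, the present vertex, and the edges of that vertex to the vertices inspected before. -/
abbrev AcceptRule (n : ℕ) : Type := History n → Vertex n → Finset (Vertex n) → Bool

/-- The online algorithm that accepts vertices by the rule `D` when they arrive by the rule `S`. -/
def ArrivalRule.withAccept {n : ℕ} {Ω : Type*} [MeasurableSpace Ω] (S : ArrivalRule n Ω)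
    (D : AcceptRule n) : OnlineAlgorithm n Ω where
  toArrivalRule := S
  accept _ := D
  measurableSet_accept _ _ _ := MeasurableSet.const _

/-! ### The two-stage rule -/

/-- A side on which `I` has at least `a` vertices, if there is one. -/
def fullSide {n : ℕ} (a : ℕ) (I : Finset (Vertex n)) : Option Bool :=
  if a ≤ sideCard true I then some true
  else if a ≤ sideCard false I then some false
  else none

/-- `none` while the first stage lasts, that is, until the constructed set has `a` vertices on one
side; from then on, that side. -/
def stage {n : ℕ} (a : ℕ) : History n → Option Bool
  | [] => fullSide a (∅ : Finset (Vertex n))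
  | x :: h =>
    match stage a h with
    | some s => some s
    | none => fullSide a (chosen (x :: h))

/-- Stage one accepts every vertex without neighbours in the constructed set, until this set has
`a` vertices on one side. Stage two accepts a vertex without neighbours in the constructed set only
if it lies on the other side and the constructed set has fewer than `r` vertices there. -/
def twoStageRule (n a r : ℕ) : AcceptRule n := fun h v N =>
  decide (Disjoint N (chosen h)) &&
    match stage a h with
    | none => true
    | some s => decide (v.isLeft ≠ s) && decide (sideCard v.isLeft (chosen h) < r)

/-- The computational threshold `α_COMP = log_b n / γ`, where `b = 1 / (1 - p)`. -/
noncomputable def alphaComp (p : unitInterval) (γ : ℝ) (n : ℕ) : ℝ :=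
  Real.logb (1 / (1 - (p : ℝ))) (n : ℝ) / γ

end BipOnline

namespace BipOnline

variable {n : ℕ}

/-- One round of a deterministic run: select the next vertex by `σ` and decide by `D`. -/
def step (σ : History n → Vertex n) (D : AcceptRule n) (E : EdgeVec n) (h : History n) :
    History n :=
  ⟨σ h, (seen h).filter fun u => adj E (σ h) u,
    D h (σ h) ((seen h).filter fun u => adj E (σ h) u)⟩ :: h

theorem history_withAccept {Ω : Type*} [MeasurableSpace Ω] (S : ArrivalRule n Ω)
    (D : AcceptRule n) (ω : Ω) (E : EdgeVec n) (t : ℕ) :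
    (S.withAccept D).history ω E t = (step (S.select ω) D E)^[t] [] := by
  induction t with
  | zero => rfl
  | succ t ih =>
    rw [Function.iterate_succ_apply', ← ih]
    rfl

theorem length_iterate_step (σ : History n → Vertex n) (D : AcceptRule n) (E : EdgeVec n) (t : ℕ)
    (h : History n) : ((step σ D E)^[t] h).length = h.length + t := by
  induction t with
  | zero => rfl
  | succ t ih =>
    rw [Function.iterate_succ_apply', step, List.length_cons, ih, add_assoc]

@[simp] theorem seen_cons (x : Round n) (h : History n) :
    seen (x :: h) = insert x.vertex (seen h) := by
  simp [seen]

@[simp] theorem chosen_cons (x : Round n) (h : History n) :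
    chosen (x :: h) = if x.accepted then insert x.vertex (chosen h) else chosen h := by
  unfold chosen
  cases hx : x.accepted <;> simp [hx]

theorem chosen_subset_seen (h : History n) : chosen h ⊆ seen h := by
  induction h with
  | nil => simp [chosen, seen]
  | cons x h ih =>
    rw [chosen_cons, seen_cons]
    split_ifs
    · exact Finset.insert_subset_insert _ ih
    · exact ih.trans (Finset.subset_insert _ _)

theorem seen_ne_univ_of_length_lt {h : History n} (hh : h.length < 2 * n) :
    seen h ≠ Finset.univ := by
  intro e
  have h1 : (seen h).card ≤ h.length := by
    simpa [seen] using List.toFinset_card_le (h.map Round.vertex)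
  rw [e, Finset.card_univ, Fintype.card_sum, Fintype.card_fin] at h1
  omega

theorem sideCard_insert (s : Bool) {v : Vertex n} {I : Finset (Vertex n)} (hv : v ∉ I) :
    sideCard s (insert v I) = sideCard s I + if v.isLeft = s then 1 else 0 := by
  unfold sideCard
  rw [Finset.filter_insert]
  split_ifs
  · rw [Finset.card_insert_of_notMem (by simp [hv])]
  · rfl

theorem sideCard_mono (s : Bool) {I J : Finset (Vertex n)} (hIJ : I ⊆ J) :
    sideCard s I ≤ sideCard s J :=
  Finset.card_le_card (Finset.filter_subset_filter _ hIJ)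

theorem sideCard_insert_le (s : Bool) (v : Vertex n) (I : Finset (Vertex n)) :
    sideCard s (insert v I) ≤ sideCard s I + if v.isLeft = s then 1 else 0 := by
  by_cases hv : v ∈ I
  · rw [Finset.insert_eq_of_mem hv]; omega
  · exact (sideCard_insert s hv).le

theorem sideCard_add_sideCard_not (s : Bool) (I : Finset (Vertex n)) :
    sideCard s I + sideCard (!s) I = I.card := by
  unfold sideCard
  rw [← Finset.card_filter_add_card_filter_not (s := I) fun v => v.isLeft = s]
  congr 2
  ext v
  cases s <;> simp

theorem sideCard_univ (s : Bool) : sideCard s (Finset.univ : Finset (Vertex n)) = n := by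
  unfold sideCard
  rw [Finset.card_filter, Fintype.sum_sum_type]
  cases s <;> simp

/-! ### The two-stage rule -/

/-- The vertices that the two-stage rule accepts if they have no neighbour in the constructed
set. -/
def eligible (a r : ℕ) (h : History n) (v : Vertex n) : Bool :=
  match stage a h with
  | none => true
  | some s => decide (v.isLeft ≠ s) && decide (sideCard v.isLeft (chosen h) < r)

theorem twoStageRule_eq (a r : ℕ) (h : History n) (v : Vertex n) (N : Finset (Vertex n)) :
    twoStageRule n a r h v N = (decide (Disjoint N (chosen h)) && eligible a r h v) := rfl

/-- The invariant of the two-stage rule: both sides are below the first threshold in stage one,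
and in stage two one side is at the first threshold and the other at most at the second. -/
structure StageInv (a r : ℕ) (h : History n) : Prop where
  lt_of_none : stage a h = none → ∀ s, sideCard s (chosen h) < a
  eq_of_some : ∀ s, stage a h = some s → sideCard s (chosen h) = a
  le_of_some : ∀ s, stage a h = some s → sideCard (!s) (chosen h) ≤ r

theorem fullSide_eq_none {a : ℕ} {I : Finset (Vertex n)} (h : fullSide a I = none) (s : Bool) :
    sideCard s I < a := by
  unfold fullSide at h
  split_ifs at h with h1 h2
  cases s <;> omega

theorem le_of_fullSide_eq_some {a : ℕ} {I : Finset (Vertex n)} {s : Bool}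
    (h : fullSide a I = some s) : a ≤ sideCard s I := by
  unfold fullSide at h
  split_ifs at h with h1 h2 <;> simp_all

theorem stageInv_nil (a r : ℕ) : StageInv a r ([] : History n) where
  lt_of_none h s := fullSide_eq_none h s
  eq_of_some s h := by
    have := le_of_fullSide_eq_some (show fullSide a (∅ : Finset (Vertex n)) = some s from h)
    simp_all [chosen, sideCard]
  le_of_some s h := by simp [chosen, sideCard]

theorem stageInv_cons {a r : ℕ} (har : a ≤ r) {h : History n} (H : StageInv a r h) {v : Vertex n}
    (hv : v ∉ seen h) (N : Finset (Vertex n)) :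
    StageInv a r (⟨v, N, twoStageRule n a r h v N⟩ :: h) := by
  have hv' : v ∉ chosen h := fun hc => hv (chosen_subset_seen h hc)
  set x : Round n := ⟨v, N, twoStageRule n a r h v N⟩ with hx
  cases hs : stage a h with
  | none =>
    have hst : stage a (x :: h) = fullSide a (chosen (x :: h)) := by simp [stage, hs]
    have hle : ∀ s, sideCard s (chosen (x :: h)) ≤ a := by
      intro s
      have h1 := H.lt_of_none hs s
      rw [chosen_cons]
      split_ifs
      · have := sideCard_insert_le s v (chosen h)
        simp only [hx] at *
        split_ifs at this <;> omega
      · exact h1.le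
    refine ⟨fun h0 s => fullSide_eq_none (hst ▸ h0) s, fun s h0 => ?_, fun s _ => (hle _).trans har⟩
    exact (hle s).antisymm (le_of_fullSide_eq_some (hst ▸ h0))
  | some s =>
    have hst : stage a (x :: h) = some s := by simp [stage, hs]
    have h1 := H.eq_of_some s hs
    have h2 := H.le_of_some s hs
    refine ⟨fun h0 => by simp [hst] at h0, fun s' h0 => ?_, fun s' h0 => ?_⟩ <;>
    · obtain rfl : s = s' := by simpa [hst] using h0
      rw [chosen_cons]
      split_ifs with hacc
      · simp only [hx, twoStageRule_eq, eligible, hs, Bool.and_eq_true, decide_eq_true_eq] at hacc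
        obtain ⟨-, h3, h4⟩ := hacc
        have h5 : v.isLeft = !s := by revert h3; cases v.isLeft <;> cases s <;> simp
        rw [hx, sideCard_insert _ hv', h5]
        rw [h5] at h4
        cases s <;> simp at * <;> omega
      · assumption

theorem StageInv.card_chosen_le {a r : ℕ} (har : a ≤ r) {h : History n} (H : StageInv a r h) :
    (chosen h).card ≤ a + r := by
  cases hs : stage a h with
  | none =>
    have h1 := H.lt_of_none hs true
    have h2 := H.lt_of_none hs false
    have := sideCard_add_sideCard_not true (chosen h)
    simp only [Bool.not_true] at this
    omega
  | some s =>
    have h1 := H.eq_of_some s hs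
    have h2 := H.le_of_some s hs
    have := sideCard_add_sideCard_not s (chosen h)
    omega

/-- The number of rounds in which an eligible vertex was inspected. -/
def eligibleCount (a r : ℕ) : History n → ℕ
  | [] => 0
  | x :: h => eligibleCount a r h + if eligible a r h x.vertex then 1 else 0

theorem sideCard_seen_le_eligibleCount {a r : ℕ} (s : Bool) {h : History n}
    (h1 : stage a h = none ∨ stage a h = some s)
    (h2 : stage a h = some s → sideCard (!s) (chosen h) < r) :
    sideCard (!s) (seen h) ≤ eligibleCount a r h := by
  induction h with
  | nil => simp [seen, sideCard]
  | cons x h ih =>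
    have hst : stage a h = none ∨ stage a h = some s := by
      cases hs : stage a h with
      | none => simp
      | some s' => simp_all [stage]
    have hc : stage a h = some s → sideCard (!s) (chosen h) < r := by
      intro hs
      refine lt_of_le_of_lt (sideCard_mono _ ?_) (h2 (by simp [stage, hs]))
      rw [chosen_cons]
      split_ifs
      · exact Finset.subset_insert _ _
      · exact subset_rfl
    have h3 := ih hst hc
    have h4 := sideCard_insert_le (!s) x.vertex (seen h)
    rw [seen_cons, eligibleCount]
    split_ifs at h4 with h5
    · have h6 : eligible a r h x.vertex = true := by
        unfold eligible
        rcases hst with hs | hs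
        · simp [hs]
        · have := hc hs
          rw [hs, h5]
          cases s <;> simp_all
      rw [if_pos h6]
      omega
    · omega

/-- A set with `a` vertices on one side and `r` on the other. -/
def HasSides (a r : ℕ) (I : Finset (Vertex n)) : Prop :=
  ∃ s, sideCard s I = a ∧ sideCard (!s) I = r

theorem StageInv.le_eligibleCount {a r : ℕ} {h : History n} (H : StageInv a r h)
    (hseen : seen h = Finset.univ) (hfail : ¬ HasSides a r (chosen h)) :
    n ≤ eligibleCount a r h := by
  cases hs : stage a h with
  | none =>
    have := sideCard_seen_le_eligibleCount (a := a) (r := r) true (Or.inl hs) (by simp [hs])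
    rwa [hseen, sideCard_univ] at this
  | some s =>
    have := sideCard_seen_le_eligibleCount (a := a) (r := r) s (Or.inr hs) fun _ =>
      lt_of_le_of_ne (H.le_of_some s hs) fun h0 => hfail ⟨s, H.eq_of_some s hs, h0⟩
    rwa [hseen, sideCard_univ] at this

/-! ### Runs of the two-stage rule -/

theorem adj_comm (E : EdgeVec n) (u v : Vertex n) : adj E u v = adj E v u := by
  rcases u with i | i <;> rcases v with j | j <;> rfl

theorem adj_self (E : EdgeVec n) (u : Vertex n) : adj E u u = false := by
  rcases u with i | i <;> rfl

/-- A selection rule that never repeats a vertex while one is left. -/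
def Fresh (σ : History n → Vertex n) : Prop :=
  ∀ h, seen h ≠ Finset.univ → σ h ∉ seen h

theorem stageInv_iterate {a r : ℕ} (har : a ≤ r) {σ : History n → Vertex n} (hσ : Fresh σ)
    (E : EdgeVec n) (t : ℕ) (ht : t ≤ 2 * n) :
    StageInv a r ((step σ (twoStageRule n a r) E)^[t] []) := by
  induction t with
  | zero => exact stageInv_nil a r
  | succ t ih =>
    rw [Function.iterate_succ_apply']
    refine stageInv_cons har (ih (by omega)) (hσ _ (seen_ne_univ_of_length_lt ?_)) _
    rw [length_iterate_step]
    simp only [List.length_nil]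
    omega

theorem card_seen_iterate {σ : History n → Vertex n} (hσ : Fresh σ) (D : AcceptRule n)
    (E : EdgeVec n) (t : ℕ) (ht : t ≤ 2 * n) : (seen ((step σ D E)^[t] [])).card = t := by
  induction t with
  | zero => simp [seen]
  | succ t ih =>
    rw [Function.iterate_succ_apply', step, seen_cons, Finset.card_insert_of_notMem, ih (by omega)]
    refine hσ _ (seen_ne_univ_of_length_lt ?_)
    rw [length_iterate_step]
    simp only [List.length_nil]
    omega

theorem seen_iterate_eq_univ {σ : History n → Vertex n} (hσ : Fresh σ) (D : AcceptRule n)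
    (E : EdgeVec n) : seen ((step σ D E)^[2 * n] []) = Finset.univ := by
  rw [← Finset.card_eq_iff_eq_univ, card_seen_iterate hσ D E _ le_rfl]
  simp [two_mul]

theorem isIndepSet_chosen_iterate (a r : ℕ) (σ : History n → Vertex n) (E : EdgeVec n) (t : ℕ) :
    (bipGraph E).IsIndepSet
      (chosen ((step σ (twoStageRule n a r) E)^[t] []) : Set (Vertex n)) := by
  suffices ∀ u ∈ chosen ((step σ (twoStageRule n a r) E)^[t] []),
      ∀ v ∈ chosen ((step σ (twoStageRule n a r) E)^[t] []), adj E u v = false by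
    intro u hu v hv _ h
    have := this u hu v hv
    simp_all [bipGraph]
  induction t with
  | zero => simp [chosen]
  | succ t ih =>
    rw [Function.iterate_succ_apply']
    generalize (step σ (twoStageRule n a r) E)^[t] [] = h at ih ⊢
    rw [step, chosen_cons]
    split_ifs with hacc
    · simp only [twoStageRule_eq, Bool.and_eq_true, decide_eq_true_eq] at hacc
      have hnew : ∀ u ∈ chosen h, adj E (σ h) u = false := by
        intro u hu
        by_contra hne
        refine Finset.disjoint_left.1 hacc.1 (Finset.mem_filter.2 ⟨chosen_subset_seen h hu, ?_⟩) hu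
        simpa using hne
      intro u hu v hv
      rcases Finset.mem_insert.1 hu with rfl | hu <;> rcases Finset.mem_insert.1 hv with rfl | hv
      · exact adj_self E _
      · exact hnew v hv
      · rw [adj_comm]; exact hnew u hu
      · exact ih u hu v hv
    · exact ih

/-! ### Independence of the edges -/

instance (p : unitInterval) : IsProbabilityMeasure (bipLaw n p) := by
  unfold bipLaw; infer_instance

theorem integral_mul_of_dependsOn (p : unitInterval) {A B : Set (Fin n × Fin n)}
    (hAB : Disjoint A B) {f g : EdgeVec n → ℝ} (hf : DependsOn f A) (hg : DependsOn g B) :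
    ∫ E, f E * g E ∂bipLaw n p = (∫ E, f E ∂bipLaw n p) * ∫ E, g E ∂bipLaw n p := by
  classical
  have hind : ProbabilityTheory.iIndepFun (fun i (E : EdgeVec n) => E i) (bipLaw n p) :=
    ProbabilityTheory.iIndepFun_pi (X := fun _ b => b) fun _ => aemeasurable_id
  have h2 := hind.indepFun_finset A.toFinset B.toFinset (by simpa using hAB)
    fun i => measurable_pi_apply i
  have hf' : DependsOn f (A.toFinset : Set (Fin n × Fin n)) := by simpa using hf
  have hg' : DependsOn g (B.toFinset : Set (Fin n × Fin n)) := by simpa using hg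
  obtain ⟨φ, rfl⟩ := dependsOn_iff_exists_comp.1 hf'
  obtain ⟨ψ, rfl⟩ := dependsOn_iff_exists_comp.1 hg'
  have h3 := h2.comp (measurable_of_finite φ) (measurable_of_finite ψ)
  exact h3.integral_fun_mul_eq_mul_integral (measurable_of_finite _).aestronglyMeasurable
    (measurable_of_finite _).aestronglyMeasurable

theorem integral_of_dependsOn (p : unitInterval) {β : Type*} [Fintype β] [DecidableEq β]
    {A B : Set (Fin n × Fin n)} (hAB : Disjoint A B) {X : EdgeVec n → β} {F : β → EdgeVec n → ℝ}
    (hX : DependsOn X A) (hF : ∀ b, DependsOn (F b) B) :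
    ∫ E, F (X E) E ∂bipLaw n p = ∫ E, (∫ E', F (X E) E' ∂bipLaw n p) ∂bipLaw n p := by
  have key : ∀ G : β → EdgeVec n → ℝ, (∫ E, G (X E) E ∂bipLaw n p) =
      ∑ b, ∫ E, (if X E = b then 1 else 0) * G b E ∂bipLaw n p := by
    intro G
    rw [← integral_finsetSum _ fun b _ => Integrable.of_finite]
    simp
  rw [key, key (fun b _ => ∫ E', F b E' ∂bipLaw n p)]
  refine Finset.sum_congr rfl fun b _ => ?_
  rw [integral_mul_of_dependsOn p hAB (fun E E' h => by rw [hX h]) (hF b), integral_mul_const]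

/-- The pairs in `L × R` that join `v` to a vertex of `I`. -/
def edgesTo (v : Vertex n) (I : Finset (Vertex n)) : Finset (Fin n × Fin n) :=
  Finset.univ.filter fun e =>
    (Sum.inl e.1 = v ∧ Sum.inr e.2 ∈ I) ∨ (Sum.inr e.2 = v ∧ Sum.inl e.1 ∈ I)

/-- The pairs in `L × R` that are not contained in `I`. -/
def edgesOutside (I : Finset (Vertex n)) : Set (Fin n × Fin n) :=
  {e | ¬ (Sum.inl e.1 ∈ I ∧ Sum.inr e.2 ∈ I)}

theorem edgesTo_subset_edgesOutside {v : Vertex n} {I : Finset (Vertex n)} (hv : v ∉ I) :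
    (edgesTo v I : Set (Fin n × Fin n)) ⊆ edgesOutside I := by
  intro e he
  simp only [edgesTo, Finset.coe_filter, Finset.mem_univ, true_and, Set.mem_ofPred_eq] at he
  rintro ⟨h1, h2⟩
  rcases he with ⟨rfl, -⟩ | ⟨rfl, -⟩ <;> exact hv ‹_›

theorem disjoint_edgesTo_edgesOutside (v : Vertex n) (I : Finset (Vertex n)) :
    Disjoint (edgesTo v I : Set (Fin n × Fin n)) (edgesOutside (insert v I)) := by
  rw [Set.disjoint_left]
  intro e he h
  simp only [edgesTo, Finset.coe_filter, Finset.mem_univ, true_and, Set.mem_ofPred_eq] at he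
  apply h
  rcases he with ⟨rfl, h2⟩ | ⟨rfl, h2⟩ <;> simp [h2]

theorem edgesOutside_insert_subset (v : Vertex n) (I : Finset (Vertex n)) :
    edgesOutside (insert v I) ⊆ edgesOutside I :=
  fun _ he h => he ⟨Finset.mem_insert_of_mem h.1, Finset.mem_insert_of_mem h.2⟩

theorem card_edgesTo_le (v : Vertex n) (I : Finset (Vertex n)) :
    (edgesTo v I).card ≤ sideCard (!v.isLeft) I := by
  unfold sideCard
  rcases v with i | j
  · refine Finset.card_le_card_of_injOn (fun e => Sum.inr e.2) ?_ ?_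
    · intro e he
      simp_all [edgesTo]
    · rintro ⟨e1, e2⟩ he ⟨e3, e4⟩ he' h
      simp_all [edgesTo]
  · refine Finset.card_le_card_of_injOn (fun e => Sum.inl e.1) ?_ ?_
    · intro e he
      simp_all [edgesTo]
    · rintro ⟨e1, e2⟩ he ⟨e3, e4⟩ he' h
      simp_all [edgesTo]

theorem adj_congr {E E' : EdgeVec n} {u v : Vertex n} {I : Finset (Vertex n)}
    (h : ∀ e ∈ edgesTo v I, E e = E' e) (hu : u ∈ I) : adj E v u = adj E' v u := by
  rcases v with i | i <;> rcases u with j | j <;> simp only [adj]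
  · exact h _ (by simp [edgesTo, hu])
  · exact h _ (by simp [edgesTo, hu])

theorem adj_eq_false {E : EdgeVec n} {u v : Vertex n} {I : Finset (Vertex n)}
    (h : ∀ e ∈ edgesTo v I, E e = false) (hu : u ∈ I) : adj E v u = false := by
  rw [adj_congr (E' := fun _ => false) h hu]
  rcases v with i | i <;> rcases u with j | j <;> rfl

theorem dependsOn_nbrs (v : Vertex n) (I : Finset (Vertex n)) :
    DependsOn (fun E : EdgeVec n => I.filter fun u => adj E v u) (edgesTo v I) := by
  intro E E' h
  refine Finset.filter_congr fun u hu => ?_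
  rw [adj_congr h hu]

theorem dependsOn_iterate_step {σ : History n → Vertex n} (hσ : Fresh σ) (D : AcceptRule n)
    (k : ℕ) (h : History n) (hk : h.length + k ≤ 2 * n) :
    DependsOn (fun E => (step σ D E)^[k] h) (edgesOutside (seen h)) := by
  induction k generalizing h with
  | zero => exact fun E E' _ => rfl
  | succ k ih =>
    intro E E' hE
    have hv := hσ h (seen_ne_univ_of_length_lt (by omega))
    have hN := dependsOn_nbrs (σ h) (seen h) fun e he => hE e (edgesTo_subset_edgesOutside hv he)
    simp only [Function.iterate_succ_apply]
    have hs : step σ D E h = step σ D E' h := by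
      simp only at hN
      simp only [step]
      rw [hN]
    rw [← hs]
    refine ih (step σ D E h) ?_ fun e he => hE e ?_
    · simp only [step, List.length_cons]; omega
    · rw [step, seen_cons] at he
      exact edgesOutside_insert_subset _ _ he

theorem real_forall_eq_false (p : unitInterval) (T : Finset (Fin n × Fin n)) :
    (bipLaw n p).real {E | ∀ e ∈ T, E e = false} = (1 - (p : ℝ)) ^ T.card := by
  have h1 : {E : EdgeVec n | ∀ e ∈ T, E e = false} =
      Set.univ.pi fun e => if e ∈ T then {false} else Set.univ := by
    ext E
    simp only [Set.mem_ofPred_eq, Set.mem_univ_pi]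
    refine forall_congr' fun e => ?_
    by_cases he : e ∈ T <;> simp [he]
  have h2 : ∀ e, ((ProbabilityTheory.bernoulliMeasure true false p)
      (if e ∈ T then {false} else Set.univ)).toReal = if e ∈ T then 1 - (p : ℝ) else 1 := by
    intro e
    split_ifs
    · rw [← measureReal_def, ProbabilityTheory.bernoulliMeasure_real_apply_of_notMem_of_mem] <;>
        simp
    · simp
  rw [measureReal_def, h1, bipLaw, Measure.pi_pi, ENNReal.toReal_prod, Finset.prod_congr rfl
    fun e _ => h2 e, Finset.prod_ite_mem, Finset.univ_inter, Finset.prod_const]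

/-! ### The weight of a history -/

/-- A supermartingale along the run of the two-stage rule, where `q` is a lower bound for the
acceptance probability of eligible vertices. -/
noncomputable def weight (a r : ℕ) (q : ℝ) (h : History n) : ℝ :=
  (1 / 2) ^ (chosen h).card * (1 - q / 2)⁻¹ ^ eligibleCount a r h

theorem weight_nonneg (a r : ℕ) {q : ℝ} (hq : q ≤ 1) (h : History n) : 0 ≤ weight a r q h := by
  unfold weight
  have : 0 ≤ 1 - q / 2 := by linarith
  positivity

theorem StageInv.sideCard_not_le {a r : ℕ} {h : History n} (H : StageInv a r h) {v : Vertex n}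
    (hv : eligible a r h v = true) : sideCard (!v.isLeft) (chosen h) ≤ a := by
  unfold eligible at hv
  cases hs : stage a h with
  | none => exact (H.lt_of_none hs _).le
  | some s =>
    simp only [hs, Bool.and_eq_true, decide_eq_true_eq] at hv
    have h5 : (!v.isLeft) = s := by
      have := hv.1
      revert this
      cases v.isLeft <;> cases s <;> simp
    rw [h5, H.eq_of_some s hs]

theorem StageInv.integral_weight_cons_le {a r : ℕ} {h : History n} (H : StageInv a r h)
    (p : unitInterval) {v : Vertex n} (hv : v ∉ seen h) :
    ∫ E, weight a r ((1 - (p : ℝ)) ^ a) (⟨v, (seen h).filter fun u => adj E v u,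
      twoStageRule n a r h v ((seen h).filter fun u => adj E v u)⟩ :: h) ∂bipLaw n p
      ≤ weight a r ((1 - (p : ℝ)) ^ a) h := by
  classical
  have hp0 : 0 ≤ 1 - (p : ℝ) := sub_nonneg.2 p.2.2
  have hp1 : 1 - (p : ℝ) ≤ 1 := sub_le_self _ p.2.1
  set q := (1 - (p : ℝ)) ^ a with hq
  have hq1 : q ≤ 1 := pow_le_one₀ hp0 hp1
  have hv' : v ∉ chosen h := fun hc => hv (chosen_subset_seen h hc)
  cases hel : eligible a r h v with
  | false => simp [weight, twoStageRule_eq, hel, eligibleCount]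
  | true =>
    let S : Set (EdgeVec n) :=
      {E | Disjoint ((seen h).filter fun u => adj E v u) (chosen h)}
    have hS : q ≤ (bipLaw n p).real S := by
      calc q ≤ (1 - (p : ℝ)) ^ (edgesTo v (chosen h)).card :=
            pow_le_pow_of_le_one hp0 hp1 ((card_edgesTo_le _ _).trans (H.sideCard_not_le hel))
        _ = (bipLaw n p).real {E | ∀ e ∈ edgesTo v (chosen h), E e = false} :=
            (real_forall_eq_false p _).symm
        _ ≤ _ := by
            refine measureReal_mono fun E hE => ?_
            refine Finset.disjoint_left.2 fun u hu hu' => ?_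
            have := (Finset.mem_filter.1 hu).2
            rw [adj_eq_false hE hu'] at this
            simp at this
    have hW : ∀ E, weight a r q (⟨v, (seen h).filter fun u => adj E v u,
        twoStageRule n a r h v ((seen h).filter fun u => adj E v u)⟩ :: h) =
        weight a r q h * (1 - q / 2)⁻¹ * (1 - S.indicator (fun _ => (1 / 2 : ℝ)) E) := by
      intro E
      by_cases hE : E ∈ S
      · have hE' : Disjoint ((seen h).filter fun u => adj E v u) (chosen h) := hE
        simp [weight, twoStageRule_eq, hel, eligibleCount, hE, hE', hv', pow_succ]
        ring
      · have hE' : ¬ Disjoint ((seen h).filter fun u => adj E v u) (chosen h) := hE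
        simp [weight, twoStageRule_eq, hel, eligibleCount, hE, hE', pow_succ]
        ring
    simp only [hW]
    rw [integral_const_mul, integral_sub Integrable.of_finite Integrable.of_finite,
      integral_indicator_const _ (Set.toFinite S).measurableSet]
    simp only [integral_const, probReal_univ, smul_eq_mul]
    have hpos : 0 < 1 - q / 2 := by linarith
    have hw := weight_nonneg a r hq1 h
    rw [mul_assoc]
    refine mul_le_of_le_one_right hw ?_
    rw [inv_mul_le_iff₀ hpos]
    linarith

theorem integral_weight_iterate_le {a r : ℕ} (har : a ≤ r) (p : unitInterval)
    {σ : History n → Vertex n} (hσ : Fresh σ) (k : ℕ) (h : History n) (H : StageInv a r h)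
    (hk : h.length + k ≤ 2 * n) :
    ∫ E, weight a r ((1 - (p : ℝ)) ^ a) ((step σ (twoStageRule n a r) E)^[k] h) ∂bipLaw n p
      ≤ weight a r ((1 - (p : ℝ)) ^ a) h := by
  induction k generalizing h with
  | zero => simp
  | succ k ih =>
    have hv := hσ h (seen_ne_univ_of_length_lt (by omega))
    simp only [Function.iterate_succ_apply]
    set v := σ h with hvdef
    let D := twoStageRule n a r
    let next : Finset (Vertex n) → History n := fun N => ⟨v, N, D h v N⟩ :: h
    have hlen : ∀ N, (next N).length + k ≤ 2 * n := fun N => by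
      simp only [next, List.length_cons]; omega
    have hdep : ∀ N, DependsOn (fun E =>
        weight a r ((1 - (p : ℝ)) ^ a) ((step σ D E)^[k] (next N)))
        (edgesOutside (insert v (seen h))) := by
      intro N E E' hE
      have := dependsOn_iterate_step hσ D k (next N) (hlen N) (x := E) (y := E')
        (by simpa [next] using hE)
      simp only at this ⊢
      rw [this]
    calc _ = ∫ E, (∫ E', weight a r ((1 - (p : ℝ)) ^ a) ((step σ D E')^[k]
            (next ((seen h).filter fun u => adj E v u))) ∂bipLaw n p) ∂bipLaw n p :=
          integral_of_dependsOn p (disjoint_edgesTo_edgesOutside v (seen h))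
            (F := fun N E => weight a r ((1 - (p : ℝ)) ^ a) ((step σ D E)^[k] (next N)))
            (dependsOn_nbrs v (seen h)) hdep
      _ ≤ ∫ E, weight a r ((1 - (p : ℝ)) ^ a)
            (next ((seen h).filter fun u => adj E v u)) ∂bipLaw n p :=
          integral_mono Integrable.of_finite Integrable.of_finite fun E =>
            ih _ (stageInv_cons har H hv _) (hlen _)
      _ ≤ _ := H.integral_weight_cons_le p hv

theorem real_not_hasSides_le {a r : ℕ} (har : a ≤ r) (p : unitInterval)
    {σ : History n → Vertex n} (hσ : Fresh σ) :
    (bipLaw n p).real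
      {E | ¬ HasSides a r (chosen ((step σ (twoStageRule n a r) E)^[2 * n] []))}
      ≤ 2 ^ (a + r) * (1 - (1 - (p : ℝ)) ^ a / 2) ^ n := by
  set q := (1 - (p : ℝ)) ^ a with hq
  have hq1 : q ≤ 1 := pow_le_one₀ (sub_nonneg.2 p.2.2) (sub_le_self _ p.2.1)
  have hq0 : 0 ≤ q := pow_nonneg (sub_nonneg.2 p.2.2) _
  have hpos : 0 < 1 - q / 2 := by linarith
  set W : EdgeVec n → ℝ :=
    fun E => weight a r q ((step σ (twoStageRule n a r) E)^[2 * n] []) with hW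
  have h1 : ∫ E, W E ∂bipLaw n p ≤ 1 := by
    refine (integral_weight_iterate_le har p hσ (2 * n) [] (stageInv_nil a r) (by simp)).trans ?_
    simp [weight, chosen, eligibleCount]
  set θ : ℝ := (1 / 2) ^ (a + r) * (1 - q / 2)⁻¹ ^ n with hθ
  have hθ0 : 0 < θ := by positivity
  have h2 := mul_meas_ge_le_integral_of_nonneg (μ := bipLaw n p) (f := W)
    (.of_forall fun E => weight_nonneg a r hq1 _) Integrable.of_finite θ
  have h3 : (bipLaw n p).real
      {E | ¬ HasSides a r (chosen ((step σ (twoStageRule n a r) E)^[2 * n] []))} ≤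
      (bipLaw n p).real {E | θ ≤ W E} := by
    refine measureReal_mono fun E hE => ?_
    have H := stageInv_iterate har hσ E (2 * n) le_rfl
    have hU := H.le_eligibleCount (seen_iterate_eq_univ hσ _ E) hE
    change θ ≤ weight a r q _
    unfold weight
    refine mul_le_mul (pow_le_pow_of_le_one (by norm_num) (by norm_num) (H.card_chosen_le har))
      (pow_le_pow_right₀ ?_ hU) (by positivity) (by positivity)
    rw [one_le_inv₀ hpos]
    linarith
  have h4 : 2 ^ (a + r) * (1 - q / 2) ^ n = θ⁻¹ := by
    simp [hθ, mul_comm]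
  rw [h4]
  refine h3.trans ?_
  rw [← one_div, le_div_iff₀ hθ0, mul_comm]
  exact h2.trans h1

/-! ### Optimization by the two-stage rule -/

theorem le_real_prod_of_forall_le {α β : Type*} [MeasurableSpace α] [MeasurableSpace β]
    (μ : Measure α) [IsProbabilityMeasure μ] (ν : Measure β) [IsProbabilityMeasure ν]
    {s : Set (α × β)} {δ : ℝ} (h : ∀ x, δ ≤ ν.real (Prod.mk x ⁻¹' s)) :
    δ ≤ (μ.prod ν).real s := by
  rw [measureReal_def, ← ENNReal.ofReal_le_iff_le_toReal (measure_ne_top _ _),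
    ← measure_toMeasurable, Measure.prod_apply (measurableSet_toMeasurable _ _)]
  calc ENNReal.ofReal δ = ∫⁻ _, ENNReal.ofReal δ ∂μ := by simp
    _ ≤ _ := lintegral_mono fun x => by
      refine le_trans ?_ (measure_mono (Set.preimage_mono (subset_toMeasurable (μ.prod ν) s)))
      exact (ENNReal.ofReal_le_iff_le_toReal (measure_ne_top _ _)).2 (h x)

theorem optimizes_twoStageRule {Ω : Type*} [MeasurableSpace Ω] (μ : Measure Ω)
    [IsProbabilityMeasure μ] (p : unitInterval) (S : ArrivalRule n Ω) {a r : ℕ} {γ k η : ℝ}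
    (hgood : ∀ I : Finset (Vertex n), HasSides a r I → IsBalanced γ I ∧ k ≤ (I.card : ℝ))
    (hη : ∀ σ : History n → Vertex n, Fresh σ → (bipLaw n p).real
      {E | ¬ HasSides a r (chosen ((step σ (twoStageRule n a r) E)^[2 * n] []))} ≤ η) :
    (S.withAccept (twoStageRule n a r)).Optimizes μ p γ k (1 - η) := by
  refine le_real_prod_of_forall_le μ _ fun ω => ?_
  set T := {E | HasSides a r (chosen ((step (S.select ω) (twoStageRule n a r) E)^[2 * n] []))}
  have h1 : (bipLaw n p).real Tᶜ ≤ η := hη (S.select ω) (S.select_notMem_seen ω)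
  rw [probReal_compl_eq_one_sub (Set.toFinite T).measurableSet] at h1
  refine (sub_le_comm.1 h1).trans (measureReal_mono fun E hE => ?_)
  change _ ∧ _ ∧ _
  simp only [OnlineAlgorithm.output, history_withAccept]
  exact ⟨isIndepSet_chosen_iterate a r _ E _, hgood _ hE⟩

theorem real_not_hasSides_zero (p : unitInterval) {σ : History n → Vertex n} (hσ : Fresh σ) :
    (bipLaw n p).real
      {E | ¬ HasSides 0 0 (chosen ((step σ (twoStageRule n 0 0) E)^[2 * n] []))} = 0 := by
  convert measureReal_empty
  refine Set.eq_empty_of_forall_notMem fun E hE => hE ?_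
  have H := (stageInv_iterate le_rfl hσ E (2 * n) le_rfl).card_chosen_le (a := 0) (r := 0) le_rfl
  have h0 := Finset.card_eq_zero.1 (Nat.le_zero.1 H)
  exact ⟨true, by simp [h0, sideCard]⟩

theorem HasSides.card_eq {a r : ℕ} {I : Finset (Vertex n)} (h : HasSides a r I) :
    I.card = a + r := by
  obtain ⟨s, rfl, rfl⟩ := h
  exact (sideCard_add_sideCard_not s I).symm

/-! ### The thresholds -/

/-- The size of the independent set that the two-stage rule aims at. -/
noncomputable def targetSize (ε : ℝ) (p : unitInterval) (γ : ℝ) (n : ℕ) : ℕ :=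
  ⌈(1 - ε) * alphaComp p γ n⌉₊

/-- The number of vertices that the two-stage rule collects on the smaller side. -/
noncomputable def smallSize (ε : ℝ) (p : unitInterval) (γ : ℝ) (n : ℕ) : ℕ :=
  ⌊min γ (1 - γ) * targetSize ε p γ n⌋₊

theorem two_mul_smallSize_le (ε : ℝ) (p : unitInterval) {γ : ℝ} (hγ0 : 0 < γ) (hγ1 : γ < 1)
    (n : ℕ) : 2 * smallSize ε p γ n ≤ targetSize ε p γ n := by
  have hm0 : 0 ≤ min γ (1 - γ) := le_min hγ0.le (by linarith)
  have hm : min γ (1 - γ) ≤ 1 / 2 := by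
    rcases le_total γ (1 / 2) with h | h
    · exact (min_le_left _ _).trans h
    · exact (min_le_right _ _).trans (by linarith)
  have h1 : (smallSize ε p γ n : ℝ) ≤ min γ (1 - γ) * targetSize ε p γ n :=
    Nat.floor_le (by positivity)
  have h2 : min γ (1 - γ) * (targetSize ε p γ n : ℝ) ≤ 1 / 2 * targetSize ε p γ n := by gcongr
  have h3 : (2 * smallSize ε p γ n : ℝ) ≤ targetSize ε p γ n := by linarith
  exact_mod_cast h3

theorem HasSides.isBalanced {ε : ℝ} {p : unitInterval} {γ : ℝ} (hγ0 : 0 < γ) (hγ1 : γ < 1)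
    {N : ℕ} {I : Finset (Vertex n)}
    (h : HasSides (smallSize ε p γ N) (targetSize ε p γ N - smallSize ε p γ N) I) :
    IsBalanced γ I := by
  have hle := two_mul_smallSize_le ε p hγ0 hγ1 N
  have hcard := h.card_eq
  rw [Nat.add_sub_cancel' (by omega)] at hcard
  have hm0 : 0 ≤ min γ (1 - γ) := le_min hγ0.le (by linarith)
  have h1 : (smallSize ε p γ N : ℝ) ≤ min γ (1 - γ) * targetSize ε p γ N :=
    Nat.floor_le (by positivity)
  have h2 : min γ (1 - γ) * targetSize ε p γ N < (smallSize ε p γ N : ℝ) + 1 :=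
    Nat.lt_floor_add_one _
  suffices ∃ s, |(sideCard s I : ℝ) - γ * (I.card : ℝ)| < 1 by
    obtain ⟨s | s, hs⟩ := this
    · exact Or.inr hs
    · exact Or.inl hs
  obtain ⟨s, h3, h4⟩ := h
  rw [hcard]
  rcases min_cases γ (1 - γ) with ⟨hm, -⟩ | ⟨hm, -⟩ <;> rw [hm] at h1 h2
  · refine ⟨s, ?_⟩
    rw [h3, abs_lt]
    constructor <;> linarith
  · refine ⟨!s, ?_⟩
    rw [h4, Nat.cast_sub (by omega), abs_lt]
    constructor <;> linarith

theorem eventually_log_add_rpow_le (C : ℝ) {c ε : ℝ} (hc : 0 < c) (hε : 0 < ε) :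
    ∀ᶠ x : ℝ in Filter.atTop, C * Real.log x + 1 + x ^ (ε / 2) ≤ c * x ^ ε := by
  have h1 : (fun x : ℝ => C * Real.log x) =o[Filter.atTop] fun x => x ^ ε :=
    (isLittleO_log_rpow_atTop hε).const_mul_left C
  have h2 : ∀ δ : ℝ, 0 < δ → (fun _ : ℝ => (1 : ℝ)) =o[Filter.atTop] fun x => x ^ δ :=
    fun δ hδ => (Asymptotics.isLittleO_one_left_iff ℝ).2
      (tendsto_norm_atTop_atTop.comp (tendsto_rpow_atTop hδ))
  have h3 : (fun x : ℝ => x ^ (ε / 2)) =o[Filter.atTop] fun x => x ^ ε := by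
    refine ((Asymptotics.isBigO_refl (fun x : ℝ => x ^ (ε / 2)) Filter.atTop).mul_isLittleO
      (h2 (ε / 2) (half_pos hε))).congr' (.of_forall fun x => mul_one _) ?_
    filter_upwards [Filter.eventually_gt_atTop 0] with x hx
    rw [← Real.rpow_add hx, add_halves]
  filter_upwards [((h1.add (h2 ε hε)).add h3).bound hc, Filter.eventually_ge_atTop 0] with x hx hx0
  rw [Real.norm_eq_abs, Real.norm_eq_abs, abs_of_nonneg (Real.rpow_nonneg hx0 ε)] at hx
  exact (le_abs_self _).trans hx

theorem mul_rpow_le_pow_smallSize {ε : ℝ} (hε1 : ε < 1) {p : unitInterval} (hp0 : 0 < p)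
    (hp1 : p < 1) {γ : ℝ} (hγ0 : 0 < γ) (hγ1 : γ < 1) (hn : 1 ≤ n) :
    (1 - (p : ℝ)) * (n : ℝ) ^ (ε - 1) ≤ (1 - (p : ℝ)) ^ smallSize ε p γ n := by
  have hp0' : (0 : ℝ) < p := hp0
  have hp1' : (p : ℝ) < 1 := hp1
  have hb0 : 0 < 1 - (p : ℝ) := by linarith
  have hn1 : (1 : ℝ) ≤ n := by exact_mod_cast hn
  have hn0 : (0 : ℝ) < n := by linarith
  set x := Real.logb (1 / (1 - (p : ℝ))) n with hx
  have hb1 : 1 < 1 / (1 - (p : ℝ)) := by rw [lt_div_iff₀ hb0]; linarith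
  have hx0 : 0 ≤ x := Real.logb_nonneg hb1 hn1
  have hα : 0 ≤ (1 - ε) * alphaComp p γ n := by
    unfold alphaComp
    exact mul_nonneg (by linarith) (div_nonneg hx0 hγ0.le)
  have hm0 : 0 ≤ min γ (1 - γ) := le_min hγ0.le (by linarith)
  have h1 : (smallSize ε p γ n : ℝ) ≤ (1 - ε) * x + 1 := by
    calc (smallSize ε p γ n : ℝ) ≤ min γ (1 - γ) * targetSize ε p γ n :=
          Nat.floor_le (by positivity)
      _ ≤ γ * ((1 - ε) * alphaComp p γ n + 1) := by
          gcongr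
          · exact min_le_left _ _
          · exact (Nat.ceil_lt_add_one hα).le
      _ = (1 - ε) * x + γ := by
          unfold alphaComp
          rw [← hx]
          field_simp
      _ ≤ _ := by linarith
  rw [← Real.rpow_natCast]
  refine le_trans (le_of_eq ?_) (Real.rpow_le_rpow_of_exponent_ge hb0 (by linarith) h1)
  have h2 : (1 - (p : ℝ)) ^ x = (n : ℝ)⁻¹ := by
    have h3 : (1 / (1 - (p : ℝ))) ^ x = n :=
      Real.rpow_logb (by positivity) hb1.ne' hn0
    rw [one_div, Real.inv_rpow hb0.le] at h3
    rw [← h3, inv_inv]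
  rw [Real.rpow_add hb0, Real.rpow_one, mul_comm (1 - ε) x, Real.rpow_mul hb0.le, h2,
    Real.inv_rpow hn0.le, ← Real.rpow_neg hn0.le, neg_sub, mul_comm]

theorem eventually_failure_bound_le {ε : ℝ} (hε : 0 < ε) (hε1 : ε < 1) {p : unitInterval}
    (hp0 : 0 < p) (hp1 : p < 1) {γ : ℝ} (hγ0 : 0 < γ) (hγ1 : γ < 1) :
    ∀ᶠ n : ℕ in Filter.atTop,
      2 ^ targetSize ε p γ n * (1 - (1 - (p : ℝ)) ^ smallSize ε p γ n / 2) ^ n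
        ≤ Real.exp (-(n : ℝ) ^ (ε / 2)) := by
  have hp0' : (0 : ℝ) < p := hp0
  have hp1' : (p : ℝ) < 1 := hp1
  have hb0 : 0 < 1 - (p : ℝ) := by linarith
  have hb1 : 1 < 1 / (1 - (p : ℝ)) := by rw [lt_div_iff₀ hb0]; linarith
  filter_upwards [tendsto_natCast_atTop_atTop.eventually (eventually_log_add_rpow_le
      ((1 - ε) / (γ * Real.log (1 / (1 - (p : ℝ))))) (c := (1 - p) / 2) (by linarith) hε),
    Filter.eventually_ge_atTop 1] with n hlog hn
  have hn1 : (1 : ℝ) ≤ n := by exact_mod_cast hn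
  have hn0 : (0 : ℝ) < n := by linarith
  have hq := mul_rpow_le_pow_smallSize hε1 hp0 hp1 hγ0 hγ1 hn
  set q := (1 - (p : ℝ)) ^ smallSize ε p γ n
  have hq1 : q ≤ 1 := pow_le_one₀ hb0.le (by linarith)
  have hK : (targetSize ε p γ n : ℝ) ≤
      (1 - ε) / (γ * Real.log (1 / (1 - (p : ℝ)))) * Real.log n + 1 := by
    refine (Nat.ceil_lt_add_one ?_).le.trans (le_of_eq ?_)
    · exact mul_nonneg (by linarith) (div_nonneg (Real.logb_nonneg hb1 hn1) hγ0.le)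
    · have := (Real.log_pos hb1).ne'
      rw [alphaComp, Real.logb]
      field_simp
  have hqn : (1 - (p : ℝ)) * (n : ℝ) ^ ε ≤ q * n := by
    calc (1 - (p : ℝ)) * (n : ℝ) ^ ε = (1 - (p : ℝ)) * (n : ℝ) ^ (ε - 1) * n := by
          rw [mul_assoc, Real.rpow_sub_one hn0.ne', div_mul_cancel₀ _ hn0.ne']
      _ ≤ _ := by gcongr
  have h2 : (2 : ℝ) ≤ Real.exp 1 := by
    have := Real.add_one_le_exp (1 : ℝ)
    linarith
  calc 2 ^ targetSize ε p γ n * (1 - q / 2) ^ n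
      ≤ Real.exp 1 ^ targetSize ε p γ n * Real.exp (-(q / 2)) ^ n := by
        have : 0 ≤ 1 - q / 2 := by linarith
        gcongr
        exact Real.one_sub_le_exp_neg _
    _ = Real.exp (targetSize ε p γ n - q * n / 2) := by
        rw [← Real.exp_nat_mul, ← Real.exp_nat_mul, ← Real.exp_add]
        congr 1
        ring
    _ ≤ _ := Real.exp_le_exp.2 (by linarith)

theorem targetSize_eq_zero {ε : ℝ} (hε1 : 1 ≤ ε) {p : unitInterval} (hp1 : p < 1) {γ : ℝ}
    (hγ0 : 0 < γ) (n : ℕ) : targetSize ε p γ n = 0 := by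
  have hp0' : (0 : ℝ) ≤ p := p.2.1
  have hp1' : (p : ℝ) < 1 := hp1
  have hb : 1 ≤ 1 / (1 - (p : ℝ)) := by rw [le_div_iff₀ (by linarith)]; linarith
  refine Nat.ceil_eq_zero.2 (mul_nonpos_of_nonpos_of_nonneg (by linarith) ?_)
  exact div_nonneg (div_nonneg (Real.log_natCast_nonneg n) (Real.log_nonneg hb)) hγ0.le

theorem exists_real_not_hasSides_le {ε : ℝ} (hε : 0 < ε) {p : unitInterval} (hp0 : 0 < p)
    (hp1 : p < 1) {γ : ℝ} (hγ0 : 0 < γ) (hγ1 : γ < 1) :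
    ∃ n₀ : ℕ, ∀ n, n₀ ≤ n → ∀ σ : History n → Vertex n, Fresh σ → (bipLaw n p).real
      {E | ¬ HasSides (smallSize ε p γ n) (targetSize ε p γ n - smallSize ε p γ n)
        (chosen ((step σ (twoStageRule n (smallSize ε p γ n)
          (targetSize ε p γ n - smallSize ε p γ n)) E)^[2 * n] []))}
      ≤ Real.exp (-(n : ℝ) ^ (ε / 2)) := by
  rcases lt_or_ge ε 1 with hε1 | hε1
  · obtain ⟨n₀, h0⟩ := Filter.eventually_atTop.1
      (eventually_failure_bound_le hε hε1 hp0 hp1 hγ0 hγ1)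
    refine ⟨n₀, fun n hn σ hσ => ?_⟩
    have hle := two_mul_smallSize_le ε p hγ0 hγ1 n
    refine (real_not_hasSides_le (by omega) p hσ).trans ?_
    rw [Nat.add_sub_cancel' (by omega)]
    exact h0 n hn
  · refine ⟨0, fun n _ σ hσ => ?_⟩
    have hK := targetSize_eq_zero hε1 hp1 hγ0 n
    have ha : smallSize ε p γ n = 0 := by simp [smallSize, hK]
    rw [hK, ha, real_not_hasSides_zero p hσ]
    exact (Real.exp_pos _).le

end BipOnline

theorem theorem4p3 (ε : ℝ) (hε : 0 < ε) (p : unitInterval) (hp0 : 0 < p) (hp1 : p < 1)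
    (γ : ℝ) (hγ0 : 0 < γ) (hγ1 : γ < 1) :
    ∃ D : (n : ℕ) → BipOnline.AcceptRule n,
      (∀ n, ∃ a r : ℕ, D n = BipOnline.twoStageRule n a r) ∧
      ∃ c : ℝ, 0 < c ∧ ∃ n₀ : ℕ, ∀ n : ℕ, n₀ ≤ n →
        ∀ (Ω : Type*) [MeasurableSpace Ω] (μ : MeasureTheory.Measure Ω)
          [MeasureTheory.IsProbabilityMeasure μ] (S : BipOnline.ArrivalRule n Ω),
          (S.withAccept (D n)).Optimizes μ p γ ((1 - ε) * BipOnline.alphaComp p γ n)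
            (1 - Real.exp (-c * (n : ℝ) ^ (ε / 2))) := by
  obtain ⟨n₀, h0⟩ := BipOnline.exists_real_not_hasSides_le hε hp0 hp1 hγ0 hγ1
  refine ⟨fun n => BipOnline.twoStageRule n (BipOnline.smallSize ε p γ n)
    (BipOnline.targetSize ε p γ n - BipOnline.smallSize ε p γ n), fun n => ⟨_, _, rfl⟩, 1,
    one_pos, n₀, fun n hn Ω _ μ _ S => ?_⟩
  refine BipOnline.optimizes_twoStageRule μ p S (fun I hI => ⟨hI.isBalanced hγ0 hγ1, ?_⟩) ?_
  · have hle := BipOnline.two_mul_smallSize_le ε p hγ0 hγ1 n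
    rw [hI.card_eq, Nat.add_sub_cancel' (by omega)]
    exact Nat.le_ceil _
  · simpa using h0 n hn
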